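/- Let $K\ge 1$ and $N\ge 1$ be integers. A private information retrieval (PIR) scheme with $K$ messages and $N$ replicated databases consists of the following. The messages $W_1,\dots,W_K$ are independent discrete random variables with equal entropies $H(W_1)=\cdots=H(W_K)\in(0,\infty)$. For each desired index $i\in\{1,\dots,K\}$ there are queries $Q_1^{[i]},\dots,Q_N^{[i]}$ with finite support, jointly independent of $(W_1,\dots,W_K)$. For each $n$, database $n$ answers with $A_n^{[i]}=f_n(Q_n^{[i]},W_1,\dots,W_K)$, where $f_n$ is a deterministic function not depending on $i$. The scheme is required to be - correct: $H\bigl(W_i\mid A_1^{[i]},\dots,A_N^{[i]},Q_1^{[i]},\dots,Q_N^{[i]}\bigr)=0$ for every $i$; - private: for every $n$, the query $Q_n^{[i]}$ is independent of the desired index, i.e. its distribution is the same for all $i$. The rate of the scheme is $$R=\frac{H(W_i)}{\sum_{n=1}^N H(A_n^{[i]})},$$ which does not depend on $i$. Then the capacity, that is, the maximum (in particular the supremum) of the rates of all PIR schemes with $K$ messages and $N$ databases, is $$C=\left(1+\frac1N+\frac1{N^2}+\cdots+\frac1{N^{K-1}}\right)^{-1}.$$ -/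

import Mathlib

open MeasureTheory ProbabilityTheory
open scoped ENNReal

universe u

/-- Shannon entropy `H(X) = ∑ₓ P(X = x) log (1 / P(X = x))` of a discrete random variable, in nats,
as an element of `[0, ∞]`.  (Only quotients of entropies matter below, so the base of the logarithm
is immaterial.) -/
noncomputable def entropy {Ω S : Type*} [MeasurableSpace Ω] (μ : Measure Ω) (X : Ω → S) : ℝ≥0∞ :=
  ∑' x : S, ENNReal.ofReal (Real.negMulLog (μ.real (X ⁻¹' {x})))

/-- Conditional Shannon entropy `H(X | Y) = ∑_y P(Y = y) H(X | Y = y)` of discrete random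
variables. -/
noncomputable def condEntropy {Ω S T : Type*} [MeasurableSpace Ω] (μ : Measure Ω)
    (X : Ω → S) (Y : Ω → T) : ℝ≥0∞ :=
  ∑' y : T, μ (Y ⁻¹' {y}) * entropy (μ[|Y ⁻¹' {y}]) X

/-- A private information retrieval scheme with `K` messages and `N` replicated databases. -/
structure PIRScheme (K N : ℕ) where
  /-- The probability space carrying the messages and the private randomness of the user. -/
  Ω : Type u
  [measurableSpaceΩ : MeasurableSpace Ω]
  μ : Measure Ω
  [isProbabilityMeasure : IsProbabilityMeasure μ]
  /-- The message alphabets, which are discrete. -/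
  Msg : Fin K → Type u
  [countableMsg : ∀ k, Countable (Msg k)]
  [measurableSpaceMsg : ∀ k, MeasurableSpace (Msg k)]
  [discreteMsg : ∀ k, DiscreteMeasurableSpace (Msg k)]
  /-- The query alphabets, which are finite. -/
  Query : Fin N → Type u
  [finiteQuery : ∀ n, Finite (Query n)]
  [measurableSpaceQuery : ∀ n, MeasurableSpace (Query n)]
  [discreteQuery : ∀ n, DiscreteMeasurableSpace (Query n)]
  /-- The alphabets of the answering strings, which are discrete. -/
  Ans : Fin N → Type u
  [countableAns : ∀ n, Countable (Ans n)]
  /-- The messages. -/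
  W : ∀ k, Ω → Msg k
  measurable_W : ∀ k, Measurable (W k)
  /-- `Q i n` is the query sent to database `n` when message `i` is desired. -/
  Q : Fin K → ∀ n, Ω → Query n
  measurable_Q : ∀ i n, Measurable (Q i n)
  /-- Database `n` computes its answer from the query it receives and the stored messages; it does
  not know which message is desired. -/
  answer : ∀ n, Query n → (∀ k, Msg k) → Ans n
  /-- The messages are independent. -/
  indep_messages : iIndepFun W μ
  /-- The messages are of the same size. -/
  entropy_eq : ∀ k l, entropy μ (W k) = entropy μ (W l)
  /-- The common size of the messages is positive and finite. -/
  entropy_ne_zero : ∀ k, entropy μ (W k) ≠ 0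
  entropy_ne_top : ∀ k, entropy μ (W k) ≠ ∞
  /-- The queries are independent of the messages. -/
  indep_queries : ∀ i, IndepFun (fun ω k => W k ω) (fun ω n => Q i n ω) μ
  /-- Correctness: the desired message is determined by all answers and all queries. -/
  correct : ∀ i, condEntropy μ (W i)
    (fun ω => ((fun n => answer n (Q i n ω) (fun k => W k ω), fun n => Q i n ω) :
      (∀ n, Ans n) × (∀ n, Query n))) = 0
  /-- Privacy: the query sent to any single database is independent of the desired index, that is,
  its distribution is the same for all desired indices. -/
  privacy : ∀ n i j, IdentDistrib (Q i n) (Q j n) μ μ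

attribute [instance] PIRScheme.measurableSpaceΩ PIRScheme.isProbabilityMeasure
  PIRScheme.countableMsg PIRScheme.measurableSpaceMsg PIRScheme.discreteMsg
  PIRScheme.finiteQuery PIRScheme.measurableSpaceQuery PIRScheme.discreteQuery
  PIRScheme.countableAns

namespace PIRScheme

variable {K N : ℕ}

/-- The answering string of database `n` when message `i` is desired. -/
def A (s : PIRScheme.{u} K N) (i : Fin K) (n : Fin N) (ω : s.Ω) : s.Ans n :=
  s.answer n (s.Q i n ω) (fun k => s.W k ω)

/-- The rate: size of the desired message divided by the total download cost, when message `i` is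
desired. -/
noncomputable def rate (s : PIRScheme.{u} K N) (i : Fin K) : ℝ≥0∞ :=
  entropy s.μ (s.W i) / ∑ n, entropy s.μ (s.A i n)

/-- The rate does not depend on the desired index. -/
theorem rate_eq (s : PIRScheme.{u} K N) (i j : Fin K) : s.rate i = s.rate j := by
  have hW : Measurable (fun ω k => s.W k ω) := measurable_pi_lambda _ s.measurable_W
  have key : ∀ n, entropy s.μ (s.A i n) = entropy s.μ (s.A j n) := by
    intro n
    have hi : ∀ l, IndepFun (fun ω k => s.W k ω) (s.Q l n) s.μ := fun l =>
      (s.indep_queries l).comp measurable_id (measurable_pi_apply n)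
    have hid := (IdentDistrib.refl (μ := s.μ) hW.aemeasurable).prodMk (s.privacy n i j)
      (hi i) (hi j)
    unfold entropy
    refine tsum_congr fun a => ?_
    have hm : MeasurableSet {p : (∀ k, s.Msg k) × s.Query n | s.answer n p.2 p.1 = a} :=
      (Set.to_countable _).measurableSet
    have := hid.measure_mem_eq hm
    have h2 : s.μ (s.A i n ⁻¹' {a}) = s.μ (s.A j n ⁻¹' {a}) := this
    rw [measureReal_def, measureReal_def, h2]
  unfold rate
  rw [s.entropy_eq i j, Finset.sum_congr rfl fun n _ => key n]

end PIRScheme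

/-- The set of all rates of private information retrieval schemes with `K` messages and `N`
databases. -/
def pirRates (K N : ℕ) : Set ℝ≥0∞ :=
  {R | ∃ s : PIRScheme.{u} K N, ∃ i : Fin K, s.rate i = R}

/-! Converse: let `H` be the entropy of a message, number the messages from `0`, and let `x i` be
the entropy of all answers to the queries for message `i`, given these queries and the messages
before `i`. The answers reveal message `i`, so `x i - H` is their entropy when message `i` is given
too. Given the messages up to `i`, the answers for `i + 1` have at most the sum of their individual
entropies; by privacy each of these equals the one for `i`, hence is at most `x i - H`. So `x (i+1)
≤ N (x i - H)`, and since `x (K-1) ≥ H`, it follows that `H ∑ N⁻ᵏ ≤ x 0`, which is at most the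
download (`meanPrefixEntropy_step`, `geom_le_meanPrefixEntropy`).

Achievability (`N ≥ 2`): let `R` have order `N`. The query to database `n` is a uniform key in `R^K`
with its coordinate `i` shifted by the `n`-th element of `R`. Answers are sums of one symbol per
message. In a fixed block all databases return the same interference from the undesired messages,
while the desired symbol runs through all positions, including position `0`, where it vanishes and
the interference is exposed (`symbolSums_decodable`). Using one block per element of `R^K` gives
every query the same number of answer symbols, so answers are uniform whatever the query.

Entropies live in `[0, ∞]`, so conditional inequalities are stated without subtraction. -/

/-! ### Shannon entropy on countable discrete spaces. -/

section Entropy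

theorem lintegral_comp_eq_tsum {Ω : Type*} [MeasurableSpace Ω]
    [DiscreteMeasurableSpace Ω] {S : Type*} [Countable S] (μ : Measure Ω) (X : Ω → S) (F : S → ℝ≥0∞) :
    ∫⁻ ω, F (X ω) ∂μ = ∑' x, F x * μ (X ⁻¹' {x}) := by
  let _ : MeasurableSpace S := ⊤
  rw [← lintegral_map (μ := μ) (f := F) (g := X) (.of_discrete) (.of_discrete),
    lintegral_countable']
  refine tsum_congr fun x => ?_
  rw [Measure.map_apply (.of_discrete) (.of_discrete)]

theorem measureReal_preimage_pos {Ω : Type*} [MeasurableSpace Ω] {S : Type*}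
    {μ : Measure Ω} [IsProbabilityMeasure μ] {ω : Ω}
    (h : μ {ω} ≠ 0) (X : Ω → S) : 0 < μ.real (X ⁻¹' {X ω}) := by
  refine ENNReal.toReal_pos (fun h0 => h ?_) (measure_ne_top _ _)
  exact measure_mono_null (by simp) h0

theorem tsum_measure_preimage_prodMk {Ω : Type*} [MeasurableSpace Ω] [DiscreteMeasurableSpace Ω]
    {S U : Type*} [Countable S] (μ : Measure Ω) (X : Ω → S) (Z : Ω → U) (z : U) :
    ∑' x, μ ((fun ω => (X ω, Z ω)) ⁻¹' {(x, z)}) = μ (Z ⁻¹' {z}) := by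
  rw [← measure_iUnion]
  · congr 1
    ext ω
    simp
  · intro x x' hx
    refine Set.disjoint_left.2 fun ω h h' => hx ?_
    simp only [Set.mem_preimage, Set.mem_singleton_iff, Prod.mk.injEq] at h h'
    exact h.1.symm.trans h'.1
  · exact fun _ => .of_discrete

variable {Ω : Type*} [MeasurableSpace Ω] [DiscreteMeasurableSpace Ω]
  {S T U : Type*} [Countable S] [Countable T] [Countable U]

/-- Entropy as expected surprisal: comparisons of entropies become pointwise inequalities at atoms.
-/
theorem entropy_eq_lintegral (μ : Measure Ω) [IsProbabilityMeasure μ] (X : Ω → S) :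
    entropy μ X = ∫⁻ ω, ENNReal.ofReal (-Real.log (μ.real (X ⁻¹' {X ω}))) ∂μ := by
  rw [lintegral_comp_eq_tsum μ X fun x => ENNReal.ofReal (-Real.log (μ.real (X ⁻¹' {x})))]
  refine tsum_congr fun x => ?_
  rw [← ofReal_measureReal (μ := μ) (s := X ⁻¹' {x}), mul_comm,
    ← ENNReal.ofReal_mul measureReal_nonneg, Real.negMulLog]
  ring_nf

/-- Under the integral the joint law cancels, and summing over `x` and `y` leaves the total mass of
`Z`. With `log t ≤ t - 1` this yields submodularity. -/
theorem lintegral_ratio_le_one (μ : Measure Ω) [IsProbabilityMeasure μ]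
    (X : Ω → S) (Y : Ω → T) (Z : Ω → U) :
    ∫⁻ ω, μ ((fun ω => (X ω, Z ω)) ⁻¹' {(X ω, Z ω)}) * μ ((fun ω => (Y ω, Z ω)) ⁻¹' {(Y ω, Z ω)}) /
      μ (Z ⁻¹' {Z ω}) / μ ((fun ω => (X ω, Y ω, Z ω)) ⁻¹' {(X ω, Y ω, Z ω)}) ∂μ ≤ 1 := by
  set f : S → U → ℝ≥0∞ := fun x z => μ ((fun ω => (X ω, Z ω)) ⁻¹' {(x, z)}) with hf
  set g : T → U → ℝ≥0∞ := fun y z => μ ((fun ω => (Y ω, Z ω)) ⁻¹' {(y, z)}) with hg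
  calc _ = ∑' p : S × T × U, f p.1 p.2.2 * g p.2.1 p.2.2 / μ (Z ⁻¹' {p.2.2}) /
        μ ((fun ω => (X ω, Y ω, Z ω)) ⁻¹' {p}) * μ ((fun ω => (X ω, Y ω, Z ω)) ⁻¹' {p}) :=
        lintegral_comp_eq_tsum μ (fun ω => (X ω, Y ω, Z ω)) fun p : S × T × U =>
          f p.1 p.2.2 * g p.2.1 p.2.2 / μ (Z ⁻¹' {p.2.2}) /
          μ ((fun ω => (X ω, Y ω, Z ω)) ⁻¹' {p})
    _ ≤ ∑' p : S × T × U, f p.1 p.2.2 * g p.2.1 p.2.2 / μ (Z ⁻¹' {p.2.2}) :=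
        ENNReal.tsum_le_tsum fun p => ENNReal.mul_le_of_le_div le_rfl
    _ = ∑' z : U, ∑' y : T, ∑' x : S, f x z * (g y z / μ (Z ⁻¹' {z})) := by
        rw [ENNReal.tsum_prod', ENNReal.tsum_comm, ENNReal.tsum_prod', ENNReal.tsum_comm]
        simp only [mul_div_assoc]
    _ = ∑' z : U, μ (Z ⁻¹' {z}) * (μ (Z ⁻¹' {z}) / μ (Z ⁻¹' {z})) := by
        refine tsum_congr fun z => ?_
        simp only [ENNReal.tsum_mul_right, ENNReal.tsum_mul_left, div_eq_mul_inv, hf, hg,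
          tsum_measure_preimage_prodMk]
    _ ≤ ∑' z : U, 1 * μ (Z ⁻¹' {z}) := by
        refine ENNReal.tsum_le_tsum fun z => ?_
        rw [mul_comm]
        exact mul_le_mul_left ENNReal.div_self_le_one _
    _ = 1 := by
        rw [← lintegral_comp_eq_tsum μ Z fun _ => 1]
        simp

variable [Countable Ω]

/-- If `Y` determines `X` up to null sets, then `H(X) ≤ H(Y)`. -/
theorem entropy_le_of_determines (μ : Measure Ω) [IsProbabilityMeasure μ] (X : Ω → S) (Y : Ω → T)
    (h : ∀ ω ω', μ {ω} ≠ 0 → μ {ω'} ≠ 0 → Y ω = Y ω' → X ω = X ω') :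
    entropy μ X ≤ entropy μ Y := by
  rw [entropy_eq_lintegral, entropy_eq_lintegral]
  refine lintegral_mono_ae ((ae_iff_of_countable).2 fun ω hω => ?_)
  refine ENNReal.ofReal_le_ofReal (neg_le_neg ?_)
  refine Real.log_le_log (measureReal_preimage_pos hω Y) ?_
  refine ENNReal.toReal_mono (measure_ne_top _ _) (measure_mono_ae ?_)
  refine (ae_iff_of_countable).2 fun ω' hω' hY => ?_
  exact h ω' ω hω' hω hY

theorem entropy_eq_of_determines (μ : Measure Ω) [IsProbabilityMeasure μ] (X : Ω → S) (Y : Ω → T)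
    (h : ∀ ω ω', μ {ω} ≠ 0 → μ {ω'} ≠ 0 → (X ω = X ω' ↔ Y ω = Y ω')) :
    entropy μ X = entropy μ Y :=
  le_antisymm (entropy_le_of_determines μ X Y fun _ _ h₁ h₂ => (h _ _ h₁ h₂).2)
    (entropy_le_of_determines μ Y X fun _ _ h₁ h₂ => (h _ _ h₁ h₂).1)

/-- Submodularity of entropy. -/
theorem entropy_submodular (μ : Measure Ω) [IsProbabilityMeasure μ]
    (X : Ω → S) (Y : Ω → T) (Z : Ω → U) :
    entropy μ (fun ω => (X ω, Y ω, Z ω)) + entropy μ Z ≤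
      entropy μ (fun ω => (X ω, Z ω)) + entropy μ (fun ω => (Y ω, Z ω)) := by
  -- Adding `1` on the left and the ratio integral on the right turns the claim into a pointwise
  -- `log t ≤ t - 1`, valid also when entropies are infinite.
  refine (ENNReal.add_le_add_iff_right ENNReal.one_ne_top).1 (le_trans ?_
    (add_le_add_right (lintegral_ratio_le_one μ X Y Z) _))
  simp only [entropy_eq_lintegral]
  rw [show (1 : ℝ≥0∞) = ∫⁻ _, 1 ∂μ by simp]
  simp only [← lintegral_add_left (Measurable.of_discrete)]
  refine lintegral_mono_ae ((ae_iff_of_countable).2 fun ω hω => ?_)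
  have ha := measureReal_preimage_pos hω (fun ω => (X ω, Y ω, Z ω))
  have hb := measureReal_preimage_pos hω (fun ω => (X ω, Z ω))
  have hd := measureReal_preimage_pos hω (fun ω => (Y ω, Z ω))
  have hc := measureReal_preimage_pos hω Z
  have hr : ∀ s : Set Ω, μ s = ENNReal.ofReal (μ.real s) := fun s => (ofReal_measureReal).symm
  simp only [hr]
  have hl : ∀ s : Set Ω, 0 ≤ -Real.log (μ.real s) := fun s =>
    neg_nonneg.2 (Real.log_nonpos measureReal_nonneg measureReal_le_one)
  rw [← ENNReal.ofReal_mul hb.le, ← ENNReal.ofReal_div_of_pos hc, ← ENNReal.ofReal_div_of_pos ha,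
    ← ENNReal.ofReal_one, ← ENNReal.ofReal_add (hl _) (hl _),
    ← ENNReal.ofReal_add (add_nonneg (hl _) (hl _)) zero_le_one,
    ← ENNReal.ofReal_add (hl _) (hl _),
    ← ENNReal.ofReal_add (add_nonneg (hl _) (hl _)) (by positivity)]
  refine ENNReal.ofReal_le_ofReal ?_
  generalize μ.real _ = a at *
  generalize μ.real ((fun ω => (X ω, Z ω)) ⁻¹' _) = b at *
  generalize μ.real ((fun ω => (Y ω, Z ω)) ⁻¹' _) = d at *
  generalize μ.real (Z ⁻¹' _) = c at *
  have := Real.log_le_sub_one_of_pos (x := b * d / c / a) (by positivity)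
  rw [Real.log_div (by positivity) ha.ne', Real.log_div (by positivity) hc.ne',
    Real.log_mul hb.ne' hd.ne'] at this
  linarith

/-- Subadditivity of entropy conditional on `Z`, by iterating submodularity. -/
theorem entropy_tuple_le {ι : Type*} [DecidableEq ι] {R : ι → Type*} [∀ i, Countable (R i)]
    (μ : Measure Ω) [IsProbabilityMeasure μ] (g : ∀ i, Ω → R i) (Z : Ω → U) (s : Finset ι) :
    entropy μ (fun ω => ((fun i : s => g i ω), Z ω)) + s.card * entropy μ Z ≤
      ∑ i ∈ s, entropy μ (fun ω => (g i ω, Z ω)) + entropy μ Z := by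
  induction s using Finset.induction_on with
  | empty =>
    simp only [Finset.card_empty, Nat.cast_zero, zero_mul, add_zero, Finset.sum_empty, zero_add]
    exact entropy_le_of_determines μ _ _ fun ω ω' _ _ h =>
      Prod.ext (funext fun i => absurd i.2 (Finset.notMem_empty _)) h
  | insert a s ha ih =>
    have h₁ : entropy μ (fun ω => ((fun i : ↥(insert a s) => g i ω), Z ω)) ≤
        entropy μ (fun ω => (g a ω, (fun i : s => g i ω), Z ω)) := by
      refine entropy_le_of_determines μ _ _ fun ω ω' _ _ h => ?_
      simp only [Prod.mk.injEq, funext_iff] at h ⊢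
      refine ⟨fun ⟨i, hi⟩ => ?_, h.2.2⟩
      rcases Finset.mem_insert.1 hi with rfl | hi
      · exact h.1
      · exact h.2.1 ⟨i, hi⟩
    have h₂ := entropy_submodular μ (g a) (fun ω (i : s) => g i ω) Z
    rw [Finset.card_insert_of_notMem ha, Finset.sum_insert ha]
    push_cast
    calc _ ≤ entropy μ (fun ω => (g a ω, (fun i : s => g i ω), Z ω)) +
          (s.card + 1) * entropy μ Z := add_le_add_left h₁ _
      _ = (entropy μ (fun ω => (g a ω, (fun i : s => g i ω), Z ω)) + entropy μ Z) +
          s.card * entropy μ Z := by ring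
      _ ≤ (entropy μ (fun ω => (g a ω, Z ω)) + entropy μ (fun ω => ((fun i : s => g i ω), Z ω))) +
          s.card * entropy μ Z := add_le_add_left h₂ _
      _ = entropy μ (fun ω => (g a ω, Z ω)) + (entropy μ (fun ω => ((fun i : s => g i ω), Z ω)) +
          s.card * entropy μ Z) := by ring
      _ ≤ _ := add_le_add_right ih _
      _ = _ := by ring

/-- The joint entropy of independent random variables is the sum of their entropies. -/
theorem entropy_tuple_eq_sum {ι : Type*} {R : ι → Type*} [∀ i, Countable (R i)]
    [∀ i, MeasurableSpace (R i)] [∀ i, DiscreteMeasurableSpace (R i)]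
    (μ : Measure Ω) [IsProbabilityMeasure μ] {g : ∀ i, Ω → R i} (h : iIndepFun g μ)
    (s : Finset ι) :
    entropy μ (fun ω (i : s) => g i ω) = ∑ i ∈ s, entropy μ (g i) := by
  simp only [entropy_eq_lintegral]
  rw [← lintegral_finsetSum _ fun _ _ => .of_discrete]
  refine lintegral_congr_ae ((ae_iff_of_countable).2 fun ω hω => ?_)
  have hl : ∀ s : Set Ω, 0 ≤ -Real.log (μ.real s) := fun s =>
    neg_nonneg.2 (Real.log_nonpos measureReal_nonneg measureReal_le_one)
  beta_reduce
  rw [← ENNReal.ofReal_sum_of_nonneg fun _ _ => hl _, Finset.sum_neg_distrib,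
    ← Real.log_prod fun i _ => (measureReal_preimage_pos hω (g i)).ne']
  have := h.measure_inter_preimage_eq_mul s (sets := fun i => {g i ω}) fun _ _ => .of_discrete
  have hset : (fun ω (i : s) => g i ω) ⁻¹' {fun i : s => g i ω} = ⋂ i ∈ s, g i ⁻¹' {g i ω} := by
    ext ω'
    simp [funext_iff]
  rw [hset, measureReal_def, this, ENNReal.toReal_prod]
  rfl

end Entropy

/-! ### The converse bound. -/

namespace PIRScheme

variable {K N : ℕ} (s : PIRScheme.{u} K N)

/-- The joint law of the messages. -/
noncomputable def law : Measure (∀ k, s.Msg k) := s.μ.map fun ω k => s.W k ω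

theorem measurable_messages : Measurable fun ω k => s.W k ω :=
  measurable_pi_lambda _ s.measurable_W

theorem measurable_queries (i : Fin K) : Measurable fun ω n => s.Q i n ω :=
  measurable_pi_lambda _ (s.measurable_Q i)

instance : IsProbabilityMeasure s.law :=
  Measure.isProbabilityMeasure_map s.measurable_messages.aemeasurable

theorem law_apply (B : Set (∀ k, s.Msg k)) :
    s.law B = s.μ ((fun ω k => s.W k ω) ⁻¹' B) :=
  Measure.map_apply s.measurable_messages (Set.to_countable _).measurableSet

theorem entropy_law_eval (k : Fin K) :
    entropy s.law (fun w => w k) = entropy s.μ (s.W k) := by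
  refine tsum_congr fun x => ?_
  rw [measureReal_def, law_apply, measureReal_def]
  rfl

theorem iIndepFun_law : iIndepFun (fun k (w : ∀ k, s.Msg k) => w k) s.law := by
  refine iIndepFun_iff_measure_inter_preimage_eq_mul.2 fun t B hB => ?_
  have := s.indep_messages.measure_inter_preimage_eq_mul t hB
  simp only [law_apply]
  convert this using 2
  · ext ω
    simp
  · rfl

/-- The answers to given queries, as a function of the messages. -/
def answers (q : ∀ n, s.Query n) (w : ∀ k, s.Msg k) : ∀ n, s.Ans n := fun n => s.answer n (q n) w

/-- The entropy of a function of the messages together with the first `m` messages. -/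
noncomputable def prefixEntropy {S : Type*} (m : ℕ) (g : (∀ k, s.Msg k) → S) : ℝ≥0∞ :=
  entropy s.law fun w => (g w, fun k : {k : Fin K // k ∈ Finset.univ.filter (·.val < m)} => w k)

/-- The average over the queries for message `i` of the entropy of the answers together with the
first `m` messages. -/
noncomputable def meanPrefixEntropy (i : Fin K) (m : ℕ) : ℝ≥0∞ :=
  ∫⁻ ω, s.prefixEntropy m (s.answers fun n => s.Q i n ω) ∂s.μ

theorem measure_messages_inter_queries (i : Fin K) (w : ∀ k, s.Msg k) (q : ∀ n, s.Query n) :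
    s.μ ((fun ω k => s.W k ω) ⁻¹' {w} ∩ (fun ω n => s.Q i n ω) ⁻¹' {q}) =
      s.law {w} * s.μ ((fun ω n => s.Q i n ω) ⁻¹' {q}) := by
  rw [law_apply]
  exact (s.indep_queries i).measure_inter_preimage_eq_mul _ _ (.of_discrete) (.of_discrete)

/-- Almost surely, the answers to the queries for message `i` determine message `i`. -/
theorem answers_determine (i : Fin K) (q : ∀ n, s.Query n)
    (hq : s.μ ((fun ω n => s.Q i n ω) ⁻¹' {q}) ≠ 0) (w w' : ∀ k, s.Msg k)
    (hw : s.law {w} ≠ 0) (hw' : s.law {w'} ≠ 0) (h : s.answers q w = s.answers q w') :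
    w i = w' i := by
  set Y : s.Ω → (∀ n, s.Ans n) × (∀ n, s.Query n) := fun ω =>
    (fun n => s.answer n (s.Q i n ω) (fun k => s.W k ω), fun n => s.Q i n ω) with hY
  set E := Y ⁻¹' {(s.answers q w, q)} with hE
  have hEm : MeasurableSet E := by
    have hm : MeasurableSet {p : (∀ k, s.Msg k) × (∀ n, s.Query n) |
        (s.answers p.2 p.1, p.2) = (s.answers q w, q)} := (Set.to_countable _).measurableSet
    exact (s.measurable_messages.prodMk (s.measurable_queries i)) hm
  have hsub : ∀ v, s.answers q v = s.answers q w →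
      (fun ω k => s.W k ω) ⁻¹' {v} ∩ (fun ω n => s.Q i n ω) ⁻¹' {q} ⊆ E ∩ s.W i ⁻¹' {v i} := by
    rintro v hv ω ⟨h₁, h₂⟩
    simp only [Set.mem_preimage, Set.mem_singleton_iff] at h₁ h₂
    refine ⟨?_, ?_⟩
    · simp only [hE, hY, Set.mem_preimage, Set.mem_singleton_iff, Prod.mk.injEq]
      refine ⟨?_, h₂⟩
      rw [← hv, ← h₁, ← h₂]
      rfl
    · simp [← h₁]
  -- Queries are independent of messages, so every possible message tuple occurs together with `q`.
  -- Zero conditional entropy then gives each occurring value of message `i` conditional probability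
  -- `1`, which two distinct values cannot share.
  have hpos : ∀ v, s.law {v} ≠ 0 → s.answers q v = s.answers q w →
      s.μ (E ∩ s.W i ⁻¹' {v i}) ≠ 0 := fun v hv hvw h0 => by
    refine mul_ne_zero hv hq ?_
    rw [← s.measure_messages_inter_queries i v q]
    exact measure_mono_null (hsub v hvw) h0
  have hE0 : s.μ E ≠ 0 := fun h0 =>
    hpos w hw rfl (measure_mono_null Set.inter_subset_left h0)
  have := cond_isProbabilityMeasure hE0
  have hent : entropy (s.μ[|E]) (s.W i) = 0 := by
    have := ENNReal.tsum_eq_zero.1 (s.correct i) (s.answers q w, q)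
    exact (mul_eq_zero.1 this).resolve_left hE0
  have hone : ∀ v, s.law {v} ≠ 0 → s.answers q v = s.answers q w →
      (s.μ[|E]).real (s.W i ⁻¹' {v i}) = 1 := fun v hv hvw => by
    have h0 := ENNReal.ofReal_eq_zero.1 (ENNReal.tsum_eq_zero.1 hent (v i))
    have hp : 0 < (s.μ[|E]).real (s.W i ⁻¹' {v i}) := by
      refine ENNReal.toReal_pos ?_ (measure_ne_top _ _)
      rw [cond_apply hEm]
      exact mul_ne_zero (ENNReal.inv_ne_zero.2 (measure_ne_top _ _)) (hpos v hv hvw)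
    refine le_antisymm measureReal_le_one ?_
    by_contra! hlt
    have := Real.log_neg hp hlt
    simp only [Real.negMulLog] at h0
    nlinarith
  by_contra hne
  have hdisj : Disjoint (s.W i ⁻¹' {w i}) (s.W i ⁻¹' {w' i}) :=
    Disjoint.preimage _ (Set.disjoint_singleton.2 hne)
  have hun := measureReal_union (μ := s.μ[|E]) hdisj (s.measurable_W i .of_discrete)
  rw [hone w hw rfl, hone w' hw' h.symm] at hun
  have := measureReal_le_one (μ := s.μ[|E]) (s := s.W i ⁻¹' {w i} ∪ s.W i ⁻¹' {w' i})
  linarith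

theorem ae_queries_ne_zero (i : Fin K) :
    ∀ᵐ ω ∂s.μ, s.μ ((fun ω n => s.Q i n ω) ⁻¹' {fun n => s.Q i n ω}) ≠ 0 := by
  have : ∀ᵐ q ∂s.μ.map (fun ω n => s.Q i n ω), s.μ ((fun ω n => s.Q i n ω) ⁻¹' {q}) ≠ 0 :=
    ae_iff_of_countable.2 fun q hq => by
      rwa [Measure.map_apply (s.measurable_queries i) .of_discrete] at hq
  exact ae_of_ae_map (s.measurable_queries i).aemeasurable this

/-- Decodability: indices start at `0`, so the message added to the prefix is message `i` itself. -/
theorem meanPrefixEntropy_succ (i : Fin K) :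
    s.meanPrefixEntropy i (i + 1) = s.meanPrefixEntropy i i := by
  refine lintegral_congr_ae ?_
  filter_upwards [s.ae_queries_ne_zero i] with ω hω
  refine entropy_eq_of_determines _ _ _ fun w w' hw hw' => ?_
  simp only [Prod.mk.injEq, funext_iff, Subtype.forall, Finset.mem_filter, Finset.mem_univ,
    true_and]
  refine ⟨fun h => ⟨h.1, fun k hk => h.2 k (by omega)⟩, fun h => ⟨h.1, fun k hk => ?_⟩⟩
  rcases Nat.lt_succ_iff_lt_or_eq.1 hk with hk | hk
  · exact h.2 k hk
  · rw [Fin.ext hk]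
    exact s.answers_determine i _ hω w w' hw hw' (funext h.1)

theorem card_filter_val_lt {m : ℕ} (hm : m ≤ K) :
    (Finset.univ.filter fun k : Fin K => k.val < m).card = m := by
  simp [Fin.card_filter_val_lt, hm]

theorem entropy_prefix (i : Fin K) {m : ℕ} (hm : m ≤ K) :
    entropy s.law (fun w (k : {k : Fin K // k ∈ Finset.univ.filter (·.val < m)}) => w k) =
      m * entropy s.μ (s.W i) := by
  rw [entropy_tuple_eq_sum s.law s.iIndepFun_law,
    Finset.sum_congr rfl fun k _ => (s.entropy_law_eval k).trans (s.entropy_eq k i),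
    Finset.sum_const, card_filter_val_lt hm, nsmul_eq_mul]

theorem le_meanPrefixEntropy (i j : Fin K) {m : ℕ} (hm : m ≤ K) :
    m * entropy s.μ (s.W i) ≤ s.meanPrefixEntropy j m := by
  calc m * entropy s.μ (s.W i) = ∫⁻ _, m * entropy s.μ (s.W i) ∂s.μ := by simp
    _ ≤ _ := lintegral_mono fun ω => by
      rw [← s.entropy_prefix i hm]
      exact entropy_le_of_determines _ _ _ fun w w' _ _ h => (Prod.ext_iff.1 h).2

theorem lintegral_query_eq (i j : Fin K) (n : Fin N) (F : s.Query n → ℝ≥0∞) :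
    ∫⁻ ω, F (s.Q i n ω) ∂s.μ = ∫⁻ ω, F (s.Q j n ω) ∂s.μ :=
  ((s.privacy n i j).comp (Measurable.of_discrete (f := F))).lintegral_eq

/-- Subadditivity given the first `m` messages, for fixed queries and then averaged. -/
theorem meanPrefixEntropy_le_sum (i : Fin K) {m : ℕ} (hm : m ≤ K) :
    s.meanPrefixEntropy i m + N * (m * entropy s.μ (s.W i)) ≤
      ∑ n, ∫⁻ ω, s.prefixEntropy m (s.answer n (s.Q i n ω)) ∂s.μ + m * entropy s.μ (s.W i) := by
  have hmeas : ∀ n, Measurable fun ω => s.prefixEntropy m (s.answer n (s.Q i n ω)) := fun n =>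
    (Measurable.of_discrete (f := fun q => s.prefixEntropy m (s.answer n q))).comp
      (s.measurable_Q i n)
  have hconst : ∀ c : ℝ≥0∞, c = ∫⁻ _, c ∂s.μ := fun c => by simp
  rw [← lintegral_finsetSum _ fun n _ => hmeas n, hconst (N * _), hconst (m * _),
    meanPrefixEntropy, ← lintegral_add_right _ measurable_const,
    ← lintegral_add_right _ measurable_const]
  refine lintegral_mono fun ω => ?_
  have h := entropy_tuple_le s.law (fun n => s.answer n (s.Q i n ω))
    (fun w (k : {k : Fin K // k ∈ Finset.univ.filter (·.val < m)}) => w k) Finset.univ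
  rw [s.entropy_prefix i hm, Finset.card_univ, Fintype.card_fin] at h
  simp only [lintegral_const, measure_univ, mul_one]
  refine le_trans (add_le_add_left ?_ _) h
  refine entropy_le_of_determines _ _ _ fun w w' _ _ h => ?_
  simp only [Prod.mk.injEq, funext_iff] at h ⊢
  exact ⟨fun n => h.1 ⟨n, Finset.mem_univ _⟩, h.2⟩

/-- By privacy the queries for `j` can be exchanged for those for `i`, one database at a time; each
answer is then a component of the full answer tuple for `i`. -/
theorem sum_le_mul_meanPrefixEntropy (i j : Fin K) (m : ℕ) :
    ∑ n, ∫⁻ ω, s.prefixEntropy m (s.answer n (s.Q j n ω)) ∂s.μ ≤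
      N * s.meanPrefixEntropy i m := by
  calc _ ≤ ∑ _n : Fin N, s.meanPrefixEntropy i m := Finset.sum_le_sum fun n _ => by
        rw [s.lintegral_query_eq j i n fun q => s.prefixEntropy m (s.answer n q)]
        refine lintegral_mono fun ω => ?_
        refine entropy_le_of_determines _ _ _ fun w w' _ _ h => ?_
        simp only [Prod.mk.injEq, funext_iff] at h ⊢
        exact ⟨h.1 n, h.2⟩
    _ = _ := by simp

theorem meanPrefixEntropy_zero_le (i : Fin K) :
    s.meanPrefixEntropy i 0 ≤ ∑ n, ∫⁻ ω, s.prefixEntropy 0 (s.answer n (s.Q i n ω)) ∂s.μ := by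
  simpa using s.meanPrefixEntropy_le_sum i (Nat.zero_le K)

/-- Conditioning on the query does not increase the entropy of an answer. -/
theorem lintegral_entropy_answer_le (i : Fin K) (n : Fin N) :
    ∫⁻ ω, entropy s.law (s.answer n (s.Q i n ω)) ∂s.μ ≤ entropy s.μ (s.A i n) := by
  have hind : IndepFun (fun ω k => s.W k ω) (s.Q i n) s.μ :=
    (s.indep_queries i).comp measurable_id (measurable_pi_apply n)
  have hprod := (indepFun_iff_map_prod_eq_prod_map_map s.measurable_messages.aemeasurable
    (s.measurable_Q i n).aemeasurable).1 hind
  have hmeas : ∀ F : s.Query n → ℝ≥0∞, Measurable fun ω => F (s.Q i n ω) := fun F =>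
    (Measurable.of_discrete (f := F)).comp (s.measurable_Q i n)
  have hmeasR : ∀ F : s.Query n → ℝ, Measurable fun ω => F (s.Q i n ω) := fun F =>
    (Measurable.of_discrete (f := F)).comp (s.measurable_Q i n)
  have hfin : ∀ F : s.Query n → ℝ, Integrable (fun ω => F (s.Q i n ω)) s.μ := fun F => by
    obtain ⟨C, hC⟩ := (Set.finite_range fun q => ‖F q‖).bddAbove
    exact .of_bound (hmeasR F).aestronglyMeasurable C (.of_forall fun ω => hC ⟨_, rfl⟩)
  unfold entropy
  rw [lintegral_tsum fun a => (hmeas fun q =>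
    ENNReal.ofReal (Real.negMulLog (s.law.real (s.answer n q ⁻¹' {a})))).aemeasurable]
  refine ENNReal.tsum_le_tsum fun a => ?_
  -- The law of the answer is the mixture, over queries, of its laws given the query. Jensen for the
  -- concave `Real.negMulLog` then applies to each value `a`.
  have hA : s.μ.real (s.A i n ⁻¹' {a}) =
      ∫ ω, s.law.real (s.answer n (s.Q i n ω) ⁻¹' {a}) ∂s.μ := by
    have hm : MeasurableSet {p : (∀ k, s.Msg k) × s.Query n | s.answer n p.2 p.1 = a} :=
      (Set.to_countable _).measurableSet
    have h₁ := congrArg (fun ν => ν {p : (∀ k, s.Msg k) × s.Query n | s.answer n p.2 p.1 = a}) hprod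
    rw [Measure.map_apply (s.measurable_messages.prodMk (s.measurable_Q i n)) hm,
      Measure.prod_apply_symm hm,
      lintegral_map (.of_discrete) (s.measurable_Q i n)] at h₁
    rw [integral_eq_lintegral_of_nonneg_ae (.of_forall fun ω => measureReal_nonneg)
      (hmeasR fun q => s.law.real (s.answer n q ⁻¹' {a})).aestronglyMeasurable]
    have hr : ∀ B, ENNReal.ofReal (s.law.real B) = s.law B := fun B => ofReal_measureReal
    simp only [hr]
    exact congrArg ENNReal.toReal h₁
  have hnn : ∀ ω, 0 ≤ Real.negMulLog (s.law.real (s.answer n (s.Q i n ω) ⁻¹' {a})) := fun ω =>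
    Real.negMulLog_nonneg measureReal_nonneg measureReal_le_one
  rw [hA, ← ofReal_integral_eq_lintegral_ofReal
    (hfin fun q => Real.negMulLog (s.law.real (s.answer n q ⁻¹' {a}))) (.of_forall hnn)]
  refine ENNReal.ofReal_le_ofReal ?_
  exact Real.concaveOn_negMulLog.le_map_integral Real.continuous_negMulLog.continuousOn isClosed_Ici
    (.of_forall fun ω => measureReal_nonneg) (hfin fun q => s.law.real (s.answer n q ⁻¹' {a}))
    (hfin fun q => Real.negMulLog (s.law.real (s.answer n q ⁻¹' {a})))

theorem meanPrefixEntropy_zero_le_download (i : Fin K) :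
    s.meanPrefixEntropy i 0 ≤ ∑ n, entropy s.μ (s.A i n) := by
  refine (s.meanPrefixEntropy_zero_le i).trans (Finset.sum_le_sum fun n _ => ?_)
  refine le_trans (lintegral_mono fun ω => ?_) (s.lintegral_entropy_answer_le i n)
  refine entropy_le_of_determines _ _ _ fun w w' _ _ h => ?_
  exact Prod.ext h (funext fun k => absurd k.2 (by simp))

/-- The induction step of the converse: passing from message `i` to the next message `j`. -/
theorem meanPrefixEntropy_step (i j : Fin K) (hij : j.val = i.val + 1) :
    s.meanPrefixEntropy j j + N * ((i.val + 1 : ℕ) * entropy s.μ (s.W i)) ≤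
      N * s.meanPrefixEntropy i i + (i.val + 1 : ℕ) * entropy s.μ (s.W i) := by
  have h := s.meanPrefixEntropy_le_sum j (m := i.val + 1) (by omega)
  rw [s.entropy_eq j i] at h
  rw [hij]
  refine h.trans (add_le_add_left ?_ _)
  rw [← s.meanPrefixEntropy_succ i]
  exact s.sum_le_mul_meanPrefixEntropy i j _

/-- Descends from the last message, `d` counting those after `i`: the step inequality reads `x i ≥ H
+ x (i+1) / N`, which prolongs the geometric sum by one term. -/
theorem geom_le_meanPrefixEntropy (hN : 1 ≤ N) (i : Fin K) (d : ℕ) (hd : i.val + d + 1 = K) :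
    i.val * entropy s.μ (s.W i) +
      entropy s.μ (s.W i) * ∑ k ∈ Finset.range (d + 1), (1 / (N : ℝ≥0∞)) ^ k ≤
      s.meanPrefixEntropy i i := by
  have hN0 : (N : ℝ≥0∞) ≠ 0 := by positivity
  have hNt : (N : ℝ≥0∞) ≠ ∞ := ENNReal.natCast_ne_top N
  induction d generalizing i with
  | zero =>
    rw [← s.meanPrefixEntropy_succ i]
    refine le_trans (le_of_eq ?_) (s.le_meanPrefixEntropy i i (by omega))
    simp only [zero_add, Finset.range_one, Finset.sum_singleton, pow_zero]
    push_cast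
    ring
  | succ d ih =>
    set j : Fin K := ⟨i + 1, by omega⟩ with hj
    have h := ih j (by simp only [hj]; omega)
    have hstep := (add_le_add_left h _).trans (s.meanPrefixEntropy_step i j rfl)
    rw [s.entropy_eq j i] at hstep
    set H := entropy s.μ (s.W i) with hH
    have hHt : ((i.val + 1 : ℕ) : ℝ≥0∞) * H ≠ ∞ :=
      ENNReal.mul_ne_top (ENNReal.natCast_ne_top _) (s.entropy_ne_top i)
    refine (ENNReal.mul_le_mul_iff_right hN0 hNt).1 ?_
    refine (ENNReal.add_le_add_iff_right hHt).1 (le_trans (le_of_eq ?_) hstep)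
    rw [Finset.sum_range_succ']
    have : (N : ℝ≥0∞) * ∑ k ∈ Finset.range (d + 1), (1 / (N : ℝ≥0∞)) ^ (k + 1) =
        ∑ k ∈ Finset.range (d + 1), (1 / (N : ℝ≥0∞)) ^ k := by
      rw [Finset.mul_sum]
      refine Finset.sum_congr rfl fun k _ => ?_
      rw [pow_succ', ← mul_assoc, ENNReal.mul_div_cancel hN0 hNt, one_mul]
    calc _ = H * (N * ∑ k ∈ Finset.range (d + 1), (1 / (N : ℝ≥0∞)) ^ (k + 1)) + N * ((i.val + 1 : ℕ) * H)
          + (i.val + 1 : ℕ) * H := by push_cast; ring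
      _ = _ := by rw [this]; simp only [hj]; ring

/-- The converse: no scheme has a rate above the capacity. -/
theorem rate_le (hN : 1 ≤ N) (i : Fin K) :
    s.rate i ≤ (∑ k ∈ Finset.range K, (1 / (N : ℝ≥0∞)) ^ k)⁻¹ := by
  have hK : 0 < K := i.pos
  set o : Fin K := ⟨0, hK⟩ with ho
  rw [s.rate_eq i o]
  have h := s.geom_le_meanPrefixEntropy hN o (K - 1) (by simp only [ho]; omega)
  simp only [ho, Nat.cast_zero, zero_mul, zero_add, Nat.sub_add_cancel hK] at h
  have h := h.trans (s.meanPrefixEntropy_zero_le_download o)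
  calc s.rate o ≤ entropy s.μ (s.W o) /
        (entropy s.μ (s.W o) * ∑ k ∈ Finset.range K, (1 / (N : ℝ≥0∞)) ^ k) :=
        ENNReal.div_le_div_left h _
    _ = _ := by
        rw [div_eq_mul_inv, ENNReal.mul_inv (.inl (s.entropy_ne_zero o)) (.inl (s.entropy_ne_top o)),
          ← mul_assoc, ENNReal.mul_inv_cancel (s.entropy_ne_zero o) (s.entropy_ne_top o), one_mul]

end PIRScheme

/-! ### Entropy of uniform and of determined variables. -/

section Uniform

variable {Ω : Type*} [MeasurableSpace Ω] [DiscreteMeasurableSpace Ω]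

theorem measurePreserving_equiv [Finite Ω] {μ : Measure Ω} (hμ : ∀ x y, μ {x} = μ {y}) (e : Ω ≃ Ω) :
    MeasurePreserving e μ μ := by
  refine ⟨.of_discrete, Measure.ext_of_singleton fun x => ?_⟩
  rw [Measure.map_apply .of_discrete .of_discrete,
    show e ⁻¹' {x} = {e.symm x} by ext; simp [Equiv.eq_symm_apply]]
  exact hμ _ _

/-- The entropy of a uniformly distributed random variable. -/
theorem entropy_of_uniform (μ : Measure Ω) [IsProbabilityMeasure μ] {S : Type*} [Fintype S]
    (X : Ω → S) (h : ∀ x y, μ (X ⁻¹' {x}) = μ (X ⁻¹' {y})) :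
    entropy μ X = ENNReal.ofReal (Real.log (Fintype.card S)) := by
  have hsum : ∑ x, μ.real (X ⁻¹' {x}) = 1 := by
    let _ : MeasurableSpace S := ⊤
    have := Measure.isProbabilityMeasure_map (μ := μ) (f := X) (Measurable.of_discrete).aemeasurable
    have h₁ := sum_measureReal_singleton (μ := μ.map X) Finset.univ
    rw [Finset.coe_univ, probReal_univ] at h₁
    rw [← h₁]
    refine Finset.sum_congr rfl fun x _ => ?_
    rw [map_measureReal_apply .of_discrete .of_discrete]
  have hx : ∀ x, μ.real (X ⁻¹' {x}) = (Fintype.card S : ℝ)⁻¹ := fun x => by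
    rw [Finset.sum_congr rfl fun y _ => show μ.real _ = μ.real _ from
      congrArg ENNReal.toReal (h y x)] at hsum
    rw [Finset.sum_const, Finset.card_univ, nsmul_eq_mul] at hsum
    exact eq_inv_of_mul_eq_one_right hsum
  have hS : (Fintype.card S : ℝ) ≠ 0 := fun h0 => by
    have : IsEmpty S := Fintype.card_eq_zero_iff.1 (by exact_mod_cast h0)
    simp at hsum
  unfold entropy
  rw [tsum_fintype, Finset.sum_congr rfl fun x _ => by rw [hx x], Finset.sum_const,
    Finset.card_univ, nsmul_eq_mul, ← ENNReal.ofReal_natCast, ← ENNReal.ofReal_mul (by positivity),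
    Real.negMulLog, Real.log_inv]
  congr 1
  field_simp

/-- A random variable determined by `Y` has no entropy given `Y`. -/
theorem condEntropy_eq_zero (μ : Measure Ω) [IsProbabilityMeasure μ] {S T : Type*} (X : Ω → S)
    (Y : Ω → T) (h : ∀ ω ω', Y ω = Y ω' → X ω = X ω') : condEntropy μ X Y = 0 := by
  refine ENNReal.tsum_eq_zero.2 fun y => ?_
  by_cases h0 : μ (Y ⁻¹' {y}) = 0
  · rw [h0, zero_mul]
  refine mul_eq_zero_of_right _ (ENNReal.tsum_eq_zero.2 fun x => ?_)
  suffices h₁ : μ[|Y ⁻¹' {y}].real (X ⁻¹' {x}) = 0 ∨ μ[|Y ⁻¹' {y}].real (X ⁻¹' {x}) = 1 by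
    rcases h₁ with h₁ | h₁ <;> simp [h₁]
  rw [measureReal_def, cond_apply .of_discrete]
  by_cases hx : ∃ ω ∈ Y ⁻¹' {y}, X ω = x
  · obtain ⟨ω, rfl, rfl⟩ := hx
    right
    rw [Set.inter_eq_left.2 (show Y ⁻¹' {Y ω} ⊆ X ⁻¹' {X ω} from fun ω' hω' => h ω' ω hω'),
      ENNReal.inv_mul_cancel h0 (measure_ne_top _ _), ENNReal.toReal_one]
  · left
    have : Y ⁻¹' {y} ∩ X ⁻¹' {x} = ∅ := Set.eq_empty_of_forall_notMem fun ω hω => hx ⟨ω, hω⟩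
    simp [this]

end Uniform

/-! ### Schemes with additive answers and a uniform key. -/

section LinearScheme

variable {K N : ℕ} (M G : Type u) [AddCommGroup M] [Fintype M] [MeasurableSpace M]
  [DiscreteMeasurableSpace M] [Fintype G] [Nonempty G] [MeasurableSpace G]
  [DiscreteMeasurableSpace G]

/-- The uniform distribution on tuples of messages and private keys. -/
noncomputable def uniformLaw (K : ℕ) : Measure ((Fin K → M) × G) :=
  (Measure.pi fun _ => uniformOn Set.univ).prod (uniformOn Set.univ)

theorem isProbabilityMeasure_uniformOn_univ (α : Type*) [Fintype α] [Nonempty α]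
    [MeasurableSpace α] [DiscreteMeasurableSpace α] :
    IsProbabilityMeasure (uniformOn (Set.univ : Set α)) :=
  isProbabilityMeasure_uniformOn Set.finite_univ Set.univ_nonempty

instance : IsProbabilityMeasure (uniformLaw M G K) := by
  have := isProbabilityMeasure_uniformOn_univ M
  have := isProbabilityMeasure_uniformOn_univ G
  unfold uniformLaw
  infer_instance

theorem uniformLaw_singleton (x y : (Fin K → M) × G) :
    uniformLaw M G K {x} = uniformLaw M G K {y} := by
  have := isProbabilityMeasure_uniformOn_univ M
  have := isProbabilityMeasure_uniformOn_univ G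
  have hs : ∀ z, uniformLaw M G K {z} =
      (∏ _k : Fin K, (1 / Fintype.card M : ℝ≥0∞)) * (1 / Fintype.card G : ℝ≥0∞) := fun z => by
    rw [uniformLaw, ← Set.singleton_prod_singleton, Measure.prod_prod, Measure.pi_singleton]
    simp [uniformOn_univ]
  rw [hs, hs]

variable {M G}

/-- For each key, translating the messages by a preimage of `y - x` preserves the uniform law and
matches the fibre over `x` with that over `y`; hence all fibres have equal mass. -/
theorem entropy_uniformLaw {S : Type*} [AddCommGroup S] [Fintype S] (f : G → (Fin K → M) →+ S)
    (hf : ∀ g, Function.Surjective (f g)) :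
    entropy (uniformLaw M G K) (fun ω => f ω.2 ω.1) =
      ENNReal.ofReal (Real.log (Fintype.card S)) := by
  refine entropy_of_uniform _ _ fun x y => ?_
  choose v hv using fun g => hf g (y - x)
  let e : (Fin K → M) × G ≃ (Fin K → M) × G :=
    { toFun := fun ω => (ω.1 + v ω.2, ω.2)
      invFun := fun ω => (ω.1 - v ω.2, ω.2)
      left_inv := fun ω => by simp
      right_inv := fun ω => by simp }
  have he := measurePreserving_equiv (uniformLaw_singleton M G (K := K)) e
  rw [← he.measure_preimage (s := (fun ω => f ω.2 ω.1) ⁻¹' {y})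
    (MeasurableSet.of_discrete).nullMeasurableSet]
  congr 1
  ext ω
  simp [e, hv, ← eq_sub_iff_add_eq]

theorem entropy_uniformLaw_message (k : Fin K) :
    entropy (uniformLaw M G K) (fun ω => ω.1 k) = ENNReal.ofReal (Real.log (Fintype.card M)) :=
  entropy_uniformLaw (fun _ => Pi.evalAddMonoidHom _ k) fun _ => Function.surjective_eval k

/-- The scheme in which messages and a private key are uniformly distributed, the query to each
database is a bijective function of the key, and the answers are additive functions of the
messages which, for each query, take all values. -/
noncomputable def linearScheme [Nontrivial M] (hN : 1 ≤ N) (σ : Fin K → Fin N → Equiv.Perm G)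
    (A : Type u) [AddCommGroup A] [Fintype A] (f : G → (Fin K → M) →+ A)
    (hdec : ∀ i g d, (∀ n, f (σ i n g) d = 0) → d i = 0) : PIRScheme.{u} K N :=
  { Ω := (Fin K → M) × G
    μ := uniformLaw M G K
    Msg := fun _ => M
    Query := fun _ => G
    Ans := fun _ => A
    W := fun k ω => ω.1 k
    measurable_W := fun _ => .of_discrete
    Q := fun i n ω => σ i n ω.2
    measurable_Q := fun _ _ => .of_discrete
    answer := fun _ q w => f q w
    indep_messages := by
      have := isProbabilityMeasure_uniformOn_univ M
      have := isProbabilityMeasure_uniformOn_univ G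
      have h : iIndepFun (fun (k : Fin K) (w : Fin K → M) => w k)
          (Measure.pi fun _ => uniformOn Set.univ) :=
        iIndepFun_pi (X := fun _ => id) fun _ => aemeasurable_id
      refine iIndepFun_iff_measure_inter_preimage_eq_mul.2 fun t B hB => ?_
      have hm := h.measure_inter_preimage_eq_mul t hB
      have hfst : ∀ C : Set (Fin K → M), uniformLaw M G K (Prod.fst ⁻¹' C) =
          (Measure.pi fun _ => uniformOn Set.univ) C := fun C => by
        rw [← Set.prod_univ, uniformLaw, Measure.prod_prod, measure_univ, mul_one]
      simp only [← hfst] at hm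
      convert hm using 2
      · ext ω
        simp
      · rfl
    entropy_eq := fun k l => (entropy_uniformLaw_message k).trans (entropy_uniformLaw_message l).symm
    entropy_ne_zero := fun k => by
      rw [entropy_uniformLaw_message k, Ne, ENNReal.ofReal_eq_zero, not_le]
      exact Real.log_pos (by exact_mod_cast Fintype.one_lt_card)
    entropy_ne_top := fun k => by
      rw [entropy_uniformLaw_message k]
      exact ENNReal.ofReal_ne_top
    indep_queries := fun i => by
      have := isProbabilityMeasure_uniformOn_univ M
      have := isProbabilityMeasure_uniformOn_univ G
      exact indepFun_prod (X := fun w : Fin K → M => w) (Y := fun g n => σ i n g)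
        .of_discrete .of_discrete
    correct := fun i => by
      refine condEntropy_eq_zero (uniformLaw M G K) _ _ fun ω ω' h => ?_
      simp only [Prod.mk.injEq, funext_iff] at h
      -- A single query already reveals the key; by additivity only the difference of the messages
      -- then matters.
      have hg : ω.2 = ω'.2 := (σ i ⟨0, hN⟩).injective (h.2 ⟨0, hN⟩)
      refine sub_eq_zero.1 (hdec i ω.2 (ω.1 - ω'.1) fun n => ?_)
      rw [map_sub, h.1 n, hg, sub_self]
    privacy := fun n i j => by
      refine ⟨(Measurable.of_discrete).aemeasurable, (Measurable.of_discrete).aemeasurable, ?_⟩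
      -- This permutation of the keys preserves the law and turns the query for `j` into the query
      -- for `i`.
      have he := measurePreserving_equiv (uniformLaw_singleton M G (K := K))
        ((Equiv.refl _).prodCongr ((σ i n).trans (σ j n).symm))
      conv_rhs => rw [← he.map_eq]
      rw [Measure.map_map .of_discrete .of_discrete]
      congr 1
      ext ω
      simp }

theorem rate_linearScheme [Nontrivial M] (hN : 1 ≤ N) (σ : Fin K → Fin N → Equiv.Perm G)
    (A : Type u) [AddCommGroup A] [Fintype A] (f : G → (Fin K → M) →+ A)
    (hf : ∀ g, Function.Surjective (f g))
    (hdec : ∀ i g d, (∀ n, f (σ i n g) d = 0) → d i = 0) (i : Fin K) :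
    (linearScheme hN σ A f hdec).rate i =
      ENNReal.ofReal (Real.log (Fintype.card M)) /
        (N * ENNReal.ofReal (Real.log (Fintype.card A))) := by
  have hW : entropy (linearScheme hN σ A f hdec).μ ((linearScheme hN σ A f hdec).W i) =
      ENNReal.ofReal (Real.log (Fintype.card M)) :=
    entropy_uniformLaw_message (M := M) (G := G) i
  have hA : ∀ n, entropy (linearScheme hN σ A f hdec).μ ((linearScheme hN σ A f hdec).A i n) =
      ENNReal.ofReal (Real.log (Fintype.card A)) := fun n =>
    entropy_uniformLaw (fun g => f (σ i n g)) fun g => hf _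
  rw [PIRScheme.rate, hW, Finset.sum_congr rfl fun n _ => hA n]
  simp

/-- With `m` symbols per message and `a` per answer over an alphabet of size `b`, the factor `log b`
cancels and the rate is `m / (N a)`. -/
theorem rate_linearScheme_eq_capacity [Nontrivial M] (hN : 1 ≤ N) (σ : Fin K → Fin N → Equiv.Perm G)
    (A : Type u) [AddCommGroup A] [Fintype A] (f : G → (Fin K → M) →+ A)
    (hf : ∀ g, Function.Surjective (f g))
    (hdec : ∀ i g d, (∀ n, f (σ i n g) d = 0) → d i = 0) (i : Fin K) {b m a : ℕ}
    (hM : Fintype.card M = b ^ m) (hA : Fintype.card A = b ^ a)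
    (hma : m * ∑ k ∈ Finset.range K, (1 / (N : ℝ≥0∞)) ^ k = N * a) :
    (linearScheme hN σ A f hdec).rate i = (∑ k ∈ Finset.range K, (1 / (N : ℝ≥0∞)) ^ k)⁻¹ := by
  have h0 := (linearScheme hN σ A f hdec).entropy_ne_zero i
  have hW : entropy (linearScheme hN σ A f hdec).μ ((linearScheme hN σ A f hdec).W i) =
      ENNReal.ofReal (Real.log (Fintype.card M)) :=
    entropy_uniformLaw_message (M := M) (G := G) i
  have hlog : ∀ c : ℕ, ENNReal.ofReal (Real.log ((b ^ c : ℕ) : ℝ)) =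
      c * ENNReal.ofReal (Real.log b) := fun c => by
    rw [Nat.cast_pow, Real.log_pow, ENNReal.ofReal_mul (by positivity), ENNReal.ofReal_natCast]
  rw [hW, hM, hlog] at h0
  rw [rate_linearScheme hN _ _ _ hf, hM, hA, hlog, hlog, ← mul_assoc, ← hma]
  set ℓ := ENNReal.ofReal (Real.log b) with hℓ
  have hm : (m : ℝ≥0∞) * ℓ ≠ ∞ := ENNReal.mul_ne_top (ENNReal.natCast_ne_top _) ENNReal.ofReal_ne_top
  rw [mul_right_comm, div_eq_mul_inv, ENNReal.mul_inv (.inl h0) (.inl hm), ← mul_assoc,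
    ENNReal.mul_inv_cancel h0 hm, one_mul]

end LinearScheme

/-! ### The capacity-achieving scheme. -/

section Capacity

variable {K N : ℕ} {R B : Type u} [AddCommGroup R] [DecidableEq R] [AddCommGroup B]

/-- The symbol of a message in a given block at a given position, which is `0` at position `0`. -/
def symbol (d : (Fin K → R) → {x : R // x ≠ 0} → B) (t : Fin K → R) (x : R) : B :=
  if h : x ≠ 0 then d t ⟨x, h⟩ else 0

/-- The answer to a query `q`: for each `r ≠ 0`, the sum over `k` of the symbols of message `k` in
the block `r - q` at the position `r k`. -/
def symbolSums (q : Fin K → R) :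
    (Fin K → (Fin K → R) → {x : R // x ≠ 0} → B) →+ ({r : Fin K → R // r ≠ 0} → B) :=
  AddMonoidHom.mk' (fun w r => ∑ k, symbol (w k) (r.1 - q) (r.1 k)) fun w w' => by
    ext r
    simp only [Pi.add_apply, ← Finset.sum_add_distrib]
    refine Finset.sum_congr rfl fun k _ => ?_
    unfold symbol
    split_ifs <;> simp

theorem symbolSums_apply (q : Fin K → R) (w : Fin K → (Fin K → R) → {x : R // x ≠ 0} → B)
    (r : {r : Fin K → R // r ≠ 0}) :
    symbolSums q w r = ∑ k, symbol (w k) (r.1 - q) (r.1 k) := rfl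

/-- Distinct `r` use distinct blocks `r - q`, so the sums can be prescribed separately: the symbols
of one message with `r k ≠ 0` carry the value, and those of the others are zero. -/
theorem symbolSums_surjective (q : Fin K → R) :
    Function.Surjective (symbolSums (B := B) q) := fun a => by
  choose κ hκ using fun r : {r : Fin K → R // r ≠ 0} => Function.ne_iff.1 r.2
  refine ⟨fun k t x => if h : t + q ≠ 0 then
    if k = κ ⟨t + q, h⟩ then a ⟨t + q, h⟩ else 0 else 0, funext fun r => ?_⟩
  rw [symbolSums_apply, Finset.sum_eq_single (κ r)]
  · have hr : r.1 (κ r) ≠ 0 := hκ r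
    simp [symbol, hr, r.2]
  · intro k _ hk
    simp [symbol, r.2, hk]
  · simp

theorem symbolSums_decodable (e : Fin N ≃ R) (i : Fin K) (g : Fin K → R)
    (d : Fin K → (Fin K → R) → {x : R // x ≠ 0} → B)
    (h : ∀ n, symbolSums (g + Pi.single i (e n)) d = 0) : d i = 0 := by
  have hsum : ∀ t x, ∑ k, symbol (d k) t ((t + (g + Pi.single i x) : Fin K → R) k) = 0 := by
    intro t x
    -- No sum is sent for `r = 0`, but it would contain only symbols at position `0`, so its value
    -- is known to be zero.
    by_cases h0 : t + (g + Pi.single i x) = 0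
    · rw [h0]
      simp [symbol]
    · have := congrFun (h (e.symm x)) ⟨_, h0⟩
      rw [symbolSums_apply] at this
      simpa using this
  have hsplit : ∀ t x, symbol (d i) t (t i + g i + x) +
      ∑ k ∈ Finset.univ.erase i, symbol (d k) t (t k + g k) = 0 := fun t x => by
    rw [← hsum t x, ← Finset.add_sum_erase _ _ (Finset.mem_univ i)]
    congr 1
    · simp [add_assoc]
    · refine Finset.sum_congr rfl fun k hk => ?_
      simp [Finset.ne_of_mem_erase hk]
  -- The shift `-(t i + g i)` puts the desired symbol at position `0`, isolating the interference.
  have hzero : ∀ t, ∑ k ∈ Finset.univ.erase i, symbol (d k) t (t k + g k) = 0 := fun t => by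
    simpa [symbol] using hsplit t (-(t i + g i))
  ext t x
  have := hsplit t (x.1 - (t i + g i))
  rw [hzero, add_zero, add_sub_cancel, symbol, dif_pos x.2] at this
  exact this

theorem mul_geom_sum_one_div (hN : 1 ≤ N) :
    ((N ^ K * (N - 1) : ℕ) : ℝ≥0∞) * ∑ k ∈ Finset.range K, (1 / (N : ℝ≥0∞)) ^ k =
      N * (N ^ K - 1 : ℕ) := by
  have hN0 : (N : ℝ≥0∞) ≠ 0 := by positivity
  have hNt : (N : ℝ≥0∞) ≠ ∞ := ENNReal.natCast_ne_top N
  have hrefl : (N : ℝ≥0∞) ^ K * ∑ k ∈ Finset.range K, (1 / (N : ℝ≥0∞)) ^ k =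
      N * ∑ k ∈ Finset.range K, (N : ℝ≥0∞) ^ k := by
    rw [← Finset.sum_range_reflect (fun k => (N : ℝ≥0∞) ^ k), Finset.mul_sum, Finset.mul_sum]
    refine Finset.sum_congr rfl fun k hk => ?_
    have hk := Finset.mem_range.1 hk
    rw [← pow_succ', one_div, ← ENNReal.inv_pow]
    nth_rewrite 1 [show K = K - 1 - k + 1 + k by omega]
    rw [pow_add, mul_assoc, ENNReal.mul_inv_cancel (pow_ne_zero _ hN0) (ENNReal.pow_ne_top hNt),
      mul_one]
  have hgeom : (N - 1) * ∑ k ∈ Finset.range K, N ^ k = N ^ K - 1 := by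
    zify [hN, Nat.one_le_pow K N hN]
    exact mul_geom_sum _ _
  rw [← hgeom]
  push_cast
  rw [mul_right_comm, hrefl]
  ring

/-- Achievability: some scheme attains the capacity. -/
theorem exists_rate_eq_capacity (hK : 1 ≤ K) (hN : 1 ≤ N) :
    (∑ k ∈ Finset.range K, (1 / (N : ℝ≥0∞)) ^ k)⁻¹ ∈ pirRates.{u} K N := by
  rcases hN.eq_or_lt with rfl | hN'
  -- For `N = 1` there are no nonzero positions, so the block scheme would have trivial messages;
  -- instead the database returns all `K` one-bit messages.
  · let _ : MeasurableSpace (ULift.{u} (ZMod 2)) := ⊤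
    have : DiscreteMeasurableSpace (ULift.{u} (ZMod 2)) := ⟨fun _ => trivial⟩
    let _ : MeasurableSpace PUnit.{u + 1} := ⊤
    have : DiscreteMeasurableSpace PUnit.{u + 1} := ⟨fun _ => trivial⟩
    refine ⟨_, ⟨0, hK⟩, rate_linearScheme_eq_capacity (M := ULift.{u} (ZMod 2)) (G := PUnit.{u + 1})
      le_rfl (fun _ _ => 1) (Fin K → ULift.{u} (ZMod 2)) (fun _ => AddMonoidHom.id _)
      (fun _ => Function.surjective_id) (fun i g d h => congrFun (h 0) i) ⟨0, hK⟩
      (b := 2) (m := 1) (a := K) (by simp) (by simp) (by simp)⟩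
  · have : NeZero N := ⟨by omega⟩
    have : Fact (1 < N) := ⟨hN'⟩
    let R := ULift.{u} (ZMod N)
    let B := ULift.{u} (ZMod 2)
    let M := (Fin K → R) → {x : R // x ≠ 0} → B
    let _ : MeasurableSpace M := ⊤
    have : DiscreteMeasurableSpace M := ⟨fun _ => trivial⟩
    let _ : MeasurableSpace (Fin K → R) := ⊤
    have : DiscreteMeasurableSpace (Fin K → R) := ⟨fun _ => trivial⟩
    have : Nonempty {x : R // x ≠ 0} := (exists_ne 0).elim fun x hx => ⟨x, hx⟩
    have hR : Fintype.card R = N := by simp [R]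
    let e : Fin N ≃ R := (Fintype.equivFinOfCardEq hR).symm
    refine ⟨_, ⟨0, hK⟩, rate_linearScheme_eq_capacity (M := M) (G := Fin K → R)
      hN (fun i n => Equiv.addRight (Pi.single i (e n))) ({r : Fin K → R // r ≠ 0} → B) symbolSums
      symbolSums_surjective (fun i g d h => symbolSums_decodable e i g d h) ⟨0, hK⟩
      -- A message has `N ^ K` blocks of `N - 1` bits; an answer has one bit for each nonzero `r`.
      (b := 2) (m := N ^ K * (N - 1)) (a := N ^ K - 1) ?_ ?_ (mul_geom_sum_one_div hN)⟩
    · simp [M, B, hR, Fintype.card_subtype_compl, ← pow_mul, mul_comm]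
    · simp [B, hR, Fintype.card_subtype_compl]

end Capacity

theorem theorem1 (K N : ℕ) (hK : 1 ≤ K) (hN : 1 ≤ N) :
    IsGreatest (pirRates.{u} K N)
      (∑ k ∈ Finset.range K, (1 / (N : ℝ≥0∞)) ^ k)⁻¹ :=
  ⟨exists_rate_eq_capacity hK hN, fun _ ⟨s, i, h⟩ => h ▸ s.rate_le hN i⟩
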